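/- A stream of length $n$ is a sequence $\mathcal P=(p_1,\dots,p_n)$ of points of $[0,1]$, and its 1-dimensional geometric discrepancy is $$D_g(\mathcal P)=\sup_{[p,q]\subseteq[0,1]}\left|(q-p)-\frac{n_{pq}}{n}\right|,\qquad n_{pq}=\#\{i : p_i\in[p,q]\}.$$ A randomized one-pass streaming algorithm with $s$ bits of space reads the stream once, in order, and keeps $s$ bits of memory between consecutive items; its transitions and its output may depend on a random string (which is not charged as space) and on the time. It gives an $(\varepsilon,\rho)$-additive solution on a stream $\mathcal P$ if its output $D$ satisfies $|D-D_g(\mathcal P)|\le\varepsilon$ with probability at least $1-\rho$. Theorem. For every $\rho\in[0,\tfrac12)$ there is a constant $c(\rho)>0$, depending only on $\rho$, such that the following holds. For every $\varepsilon\in(0,\tfrac12)$ there is a positive integer $n$, depending only on $\varepsilon$, such that for all sufficiently large $N$ (depending only on $\varepsilon$) and every $\rho\in[0,\tfrac12)$, any randomized one-pass streaming algorithm that gives an $(\varepsilon,\rho)$-additive solution to geometric discrepancy on all streams of length $n$ with points in $\{0,\tfrac1N,\tfrac2N,\dots,1\}$ uses at least $c(\rho)/\varepsilon$ bits of space, that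 is, $\Omega(1/\varepsilon)$ bits. In particular, this holds for any algorithm that is correct on all streams of $n$ points of $[0,1]$. -/

import Mathlib

open MeasureTheory

/-- The 1-dimensional geometric discrepancy `D_g(P)` of a stream `P` of `n` points of `[0,1]`:
the supremum over all closed intervals `[p,q] ⊆ [0,1]` of `|(q - p) - n_pq / n|`, where `n_pq` is
the number of points of the stream, counted with multiplicity, that lie in `[p,q]`. -/
noncomputable def geometricDiscrepancy {n : ℕ} (P : Fin n → ℝ) : ℝ :=
  sSup {d : ℝ | ∃ p q : ℝ, 0 ≤ p ∧ p ≤ q ∧ q ≤ 1 ∧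
    d = |(q - p) - (Nat.card {i : Fin n // P i ∈ Set.Icc p q} : ℝ) / (n : ℝ)|}

/-- The universe of points of bounded precision: the multiples of `1 / N` in `[0,1]`. -/
def gridPoints (N : ℕ) : Set ℝ :=
  {x : ℝ | ∃ k : ℕ, k ≤ N ∧ x = (k : ℝ) / (N : ℝ)}

/-- A randomized one-pass streaming algorithm for streams of real points with real output, whose
memory between two consecutive stream items consists of `s` bits.

All its random bits are given by a point `ω` of the probability space `Ω`, which it may inspect at
any time free of charge (so fresh private coins at each step are included), and it may also
consult a clock free of charge. Given `ω`, the algorithm starts in the memory state `init ω`; on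
reading the item `x` at time `t` in memory state `m` it passes to the state `step ω t m x`; and at
the end of the stream it outputs `out ω m`, where `m` is the final state. Measurability in `ω`
makes the output a random variable. No computability or running time bound is imposed. -/
structure StreamingAlgorithm (Ω : Type*) [MeasurableSpace Ω] (s : ℕ) where
  init : Ω → (Fin s → Bool)
  step : Ω → ℕ → (Fin s → Bool) → ℝ → (Fin s → Bool)
  out : Ω → (Fin s → Bool) → ℝ
  measurable_init : Measurable init
  measurable_step : ∀ t m x, Measurable fun ω => step ω t m x
  measurable_out : ∀ m, Measurable fun ω => out ω m

/-- The memory state after one pass over a stream of length `n`. -/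
def StreamingAlgorithm.state {Ω : Type*} [MeasurableSpace Ω] {s : ℕ}
    (A : StreamingAlgorithm Ω s) (ω : Ω) : (n : ℕ) → (Fin n → ℝ) → (Fin s → Bool)
  | 0, _ => A.init ω
  | n + 1, P => A.step ω n (A.state ω n fun i => P i.castSucc) (P (Fin.last n))

/-- The output of the algorithm on a stream of length `n`. -/
def StreamingAlgorithm.output {Ω : Type*} [MeasurableSpace Ω] {s : ℕ}
    (A : StreamingAlgorithm Ω s) (ω : Ω) {n : ℕ} (P : Fin n → ℝ) : ℝ :=
  A.out ω (A.state ω n P)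

/-- `A` outputs an `(ε, ρ)`-additive solution to the geometric discrepancy problem for all streams
of length `n` with points in the universe `U`: on each of them, its output differs from the
geometric discrepancy by at most `ε` with probability at least `1 - ρ`. -/
def StreamingAlgorithm.SolvesGeometricDiscrepancy {Ω : Type*} [MeasurableSpace Ω] {s : ℕ}
    (A : StreamingAlgorithm Ω s) (μ : Measure Ω) (ε ρ : ℝ) (n : ℕ) (U : Set ℝ) : Prop :=
  ∀ P : Fin n → ℝ, (∀ i, P i ∈ U) →
    1 - ρ ≤ μ.real {ω | |A.output ω P - geometricDiscrepancy P| ≤ ε}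

/-! The bound is a reduction from the one-way INDEX problem with public coins. A string of `m` bits
becomes a prefix of `m` points, a mark at `z j` or a dummy at 0; the suffix is `3m` copies of the
queried `z i`. The degenerate interval at `z i` has excess mass `3/4`, plus `1/(4m)` if bit `i` is
set, and no interval does better (`geometricDiscrepancy_indexStream`). An error below `1/(8m)` thus
reveals the bit, and the memory after the prefix is a message for INDEX, so `index_lower_bound`
gives order `m` bits. Take `m` just below `1/(8ε)`.

For `ε ≥ 1/16` one bit is enough: a nearly uniform stream and a constant one have discrepancies more
than `2ε` apart, which a memoryless algorithm cannot tell apart. -/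

theorem natCard_subtype_eq_sum {n : ℕ} (P : Fin n → ℝ) (S : Set ℝ) [DecidablePred (· ∈ S)] :
    (Nat.card {i : Fin n // P i ∈ S} : ℝ) = ∑ i, if P i ∈ S then (1 : ℝ) else 0 := by
  rw [Nat.card_eq_fintype_card, Fintype.card_subtype, Finset.sum_boole]

theorem natCard_subtype_le {n : ℕ} (P : Fin n → ℝ) (S : Set ℝ) :
    (Nat.card {i : Fin n // P i ∈ S} : ℝ) ≤ n := by
  classical
  rw [Nat.card_eq_fintype_card]
  exact_mod_cast (Fintype.card_subtype_le _).trans_eq (Fintype.card_fin n)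

theorem geometricDiscrepancy_le {n : ℕ} {P : Fin n → ℝ} {D : ℝ}
    (h : ∀ p q : ℝ, 0 ≤ p → p ≤ q → q ≤ 1 →
      |(q - p) - (Nat.card {i : Fin n // P i ∈ Set.Icc p q} : ℝ) / (n : ℝ)| ≤ D) :
    geometricDiscrepancy P ≤ D := by
  refine csSup_le ⟨_, 0, 0, le_rfl, le_rfl, zero_le_one, rfl⟩ ?_
  rintro d ⟨p, q, hp, hpq, hq, rfl⟩
  exact h p q hp hpq hq

theorem le_geometricDiscrepancy {n : ℕ} (P : Fin n → ℝ) {p q : ℝ}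
    (hp : 0 ≤ p) (hpq : p ≤ q) (hq : q ≤ 1) :
    |(q - p) - (Nat.card {i : Fin n // P i ∈ Set.Icc p q} : ℝ) / (n : ℝ)| ≤
      geometricDiscrepancy P := by
  refine le_csSup ⟨1, ?_⟩ ⟨p, q, hp, hpq, hq, rfl⟩
  rintro d ⟨p, q, hp, hpq, hq, rfl⟩
  have h0 : (Nat.card {i : Fin n // P i ∈ Set.Icc p q} : ℝ) / n ≤ 1 :=
    div_le_one_of_le₀ (natCard_subtype_le P _) n.cast_nonneg
  have h1 : 0 ≤ (Nat.card {i : Fin n // P i ∈ Set.Icc p q} : ℝ) / n := by positivity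
  rw [abs_le]
  constructor <;> linarith

/-! ### Measurability and composition of streaming algorithms -/

section Algorithm

variable {Ω : Type*} [MeasurableSpace Ω] {s : ℕ}

theorem StreamingAlgorithm.measurable_state (A : StreamingAlgorithm Ω s) :
    ∀ (n : ℕ) (P : Fin n → ℝ), Measurable fun ω => A.state ω n P
  | 0, _ => A.measurable_init
  | n + 1, P => by
    have h : Measurable fun z : Ω × (Fin s → Bool) => A.step z.1 n z.2 (P (Fin.last n)) :=
      measurable_from_prod_countable_left fun m => A.measurable_step n m _
    exact h.comp (measurable_id.prodMk (A.measurable_state n _))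

theorem StreamingAlgorithm.measurable_output (A : StreamingAlgorithm Ω s) {n : ℕ}
    (P : Fin n → ℝ) : Measurable fun ω => A.output ω P := by
  have h : Measurable fun z : Ω × (Fin s → Bool) => A.out z.1 z.2 :=
    measurable_from_prod_countable_left fun m => A.measurable_out m
  exact h.comp (measurable_id.prodMk (A.measurable_state n P))

theorem StreamingAlgorithm.measurableSet_output (A : StreamingAlgorithm Ω s) {n : ℕ}
    (P : Fin n → ℝ) (D ε : ℝ) : MeasurableSet {ω | |A.output ω P - D| ≤ ε} :=
  measurableSet_le ((A.measurable_output P).sub_const D).abs measurable_const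

/-- The state after a stream depends on the prefix only through the intermediate state. -/
theorem StreamingAlgorithm.state_append_congr (A : StreamingAlgorithm Ω s) (ω : Ω) {a : ℕ}
    {P P' : Fin a → ℝ} (h : A.state ω a P = A.state ω a P') :
    ∀ (b : ℕ) (Q : Fin b → ℝ),
      A.state ω (a + b) (Fin.append P Q) = A.state ω (a + b) (Fin.append P' Q)
  | 0, Q => by
    have e (R : Fin a → ℝ) : Fin.append R Q = R := by
      ext i
      exact Fin.append_left R Q i
    change A.state ω a (Fin.append P Q) = A.state ω a (Fin.append P' Q)
    rw [e, e, h]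
  | b + 1, Q => by
    have e (R : Fin a → ℝ) :
        (fun i : Fin (a + b) => (Fin.append R Q : Fin (a + (b + 1)) → ℝ) (Fin.castSucc i : Fin (a + b + 1))) =
          Fin.append R fun i => Q i.castSucc := by
      ext i
      refine Fin.addCases (fun j => ?_) (fun j => ?_) i
      · rw [Fin.append_left]
        exact Fin.append_left R Q j
      · rw [Fin.append_right]
        exact Fin.append_right R Q j.castSucc
    have l (R : Fin a → ℝ) :
        (Fin.append R Q : Fin (a + (b + 1)) → ℝ) (Fin.last (a + b)) = Q (Fin.last b) :=
      Fin.append_right R Q (Fin.last b)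
    have st (R : Fin a → ℝ) : A.state ω (a + (b + 1)) (Fin.append R Q) =
        A.step ω (a + b) (A.state ω (a + b) (Fin.append R fun i => Q i.castSucc))
          (Q (Fin.last b)) := by
      rw [← e, ← l R]
      rfl
    rw [st, st, A.state_append_congr ω h b]

/-- A correct algorithm has some memory, if two streams have sufficiently different discrepancy. -/
theorem StreamingAlgorithm.SolvesGeometricDiscrepancy.space_pos (A : StreamingAlgorithm Ω s)
    (μ : Measure Ω) [IsProbabilityMeasure μ] {ε ρ : ℝ} (hρ : ρ < 1 / 2) {n : ℕ} {U : Set ℝ}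
    (hA : A.SolvesGeometricDiscrepancy μ ε ρ n U) {P Q : Fin n → ℝ}
    (hP : ∀ i, P i ∈ U) (hQ : ∀ i, Q i ∈ U)
    (h : geometricDiscrepancy P + 2 * ε < geometricDiscrepancy Q) : 1 ≤ s := by
  by_contra! hs
  obtain rfl : s = 0 := by lia
  have hd : Disjoint {ω | |A.output ω P - geometricDiscrepancy P| ≤ ε}
      {ω | |A.output ω Q - geometricDiscrepancy Q| ≤ ε} := by
    rw [Set.disjoint_left]
    intro ω h1 h2
    -- Zero bits leave a single memory state, so the two success events, each of measure above
    -- `1/2`, would be disjoint.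
    have e : A.output ω P = A.output ω Q := congrArg (A.out ω) (Subsingleton.elim _ _)
    rw [Set.mem_ofPred_eq, abs_le] at h1 h2
    linarith [h1.2, h2.1]
  have hu := measureReal_union (μ := μ) hd (A.measurableSet_output Q _ ε)
  have h1 := hA P hP
  have h2 := hA Q hQ
  have h3 := measureReal_le_one (μ := μ)
    (s := {ω | |A.output ω P - geometricDiscrepancy P| ≤ ε} ∪
      {ω | |A.output ω Q - geometricDiscrepancy Q| ≤ ε})
  linarith

end Algorithm

/-! ### The INDEX problem by exponential moments -/

section Index

/-- The exponential moment of the number of agreements of a uniform bit string with `y`. -/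
theorem sum_exp_agreement {m : ℕ} (y : Fin m → Bool) (l : ℝ) :
    ∑ x : Fin m → Bool, Real.exp (l * ∑ i, if y i = x i then (1 : ℝ) else 0) =
      (1 + Real.exp l) ^ m := by
  have h1 (x : Fin m → Bool) : Real.exp (l * ∑ i, if y i = x i then (1 : ℝ) else 0) =
      ∏ i, if y i = x i then Real.exp l else 1 := by
    rw [Finset.mul_sum, Real.exp_sum]
    refine Finset.prod_congr rfl fun i _ => ?_
    split_ifs <;> simp
  have h2 : ∀ i : Fin m, ∑ b : Bool, (if y i = b then Real.exp l else 1) = 1 + Real.exp l := by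
    intro i
    cases y i <;> simp [add_comm]
  simp_rw [h1]
  rw [← Fintype.piFinset_univ, ← Finset.prod_univ_sum (fun _ : Fin m => (Finset.univ : Finset Bool))
    (fun i b => if y i = b then Real.exp l else 1)]
  rw [Finset.prod_congr rfl fun i _ => h2 i]
  simp

/-- Hoeffding's bound for a fair bit, from `cosh t ≤ exp (t²/2)` at `t = l/2`. -/
theorem one_add_exp_le (l : ℝ) : 1 + Real.exp l ≤ 2 * Real.exp (l / 2 + l ^ 2 / 8) := by
  have h := Real.cosh_le_exp_half_sq (l / 2)
  rw [Real.cosh_eq] at h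
  have e1 : 1 + Real.exp l =
      2 * (Real.exp (l / 2) * ((Real.exp (l / 2) + Real.exp (-(l / 2))) / 2)) := by
    have a : Real.exp (l / 2) * Real.exp (l / 2) = Real.exp l := by
      rw [← Real.exp_add]; ring_nf
    have b : Real.exp (l / 2) * Real.exp (-(l / 2)) = 1 := by
      rw [← Real.exp_add]; simp
    linear_combination -a - b
  rw [e1, Real.exp_add, show l ^ 2 / 8 = (l / 2) ^ 2 / 2 by ring]
  gcongr

/-- The average number of bits of a uniform string of length `m` that can be recovered from a
message of `s` bits. -/
theorem sum_agreement_le {m s : ℕ} (M : (Fin m → Bool) → (Fin s → Bool))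
    (g : (Fin s → Bool) → (Fin m → Bool)) (l : ℝ) :
    l * ∑ x : Fin m → Bool, ∑ i, (if g (M x) i = x i then (1 : ℝ) else 0) ≤
      (s + m * (l / 2 + l ^ 2 / 8)) * 2 ^ m := by
  set a : (Fin m → Bool) → ℝ := fun x => ∑ i, if g (M x) i = x i then (1 : ℝ) else 0
  set K : ℝ := s + m * (l / 2 + l ^ 2 / 8)
  have hsum : ∑ x, Real.exp (l * a x) ≤ 2 ^ m * Real.exp K := by
    -- Union bound over messages: for a fixed message the guess is a fixed string, whose agreements
    -- have a known moment.
    calc ∑ x, Real.exp (l * a x)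
        ≤ ∑ x : Fin m → Bool, ∑ c : Fin s → Bool,
            Real.exp (l * ∑ i, if g c i = x i then (1 : ℝ) else 0) := by
          refine Finset.sum_le_sum fun x _ => ?_
          exact Finset.single_le_sum
            (f := fun c => Real.exp (l * ∑ i, if g c i = x i then (1 : ℝ) else 0))
            (fun c _ => (Real.exp_pos _).le) (Finset.mem_univ (M x))
      _ = 2 ^ s * (1 + Real.exp l) ^ m := by
          rw [Finset.sum_comm]
          simp_rw [sum_exp_agreement]
          simp
      _ ≤ Real.exp 1 ^ s * (2 * Real.exp (l / 2 + l ^ 2 / 8)) ^ m := by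
          have : (2 : ℝ) ≤ Real.exp 1 := by linarith [Real.add_one_le_exp (1 : ℝ)]
          gcongr
          exact one_add_exp_le l
      _ = 2 ^ m * Real.exp K := by
          rw [mul_pow, ← Real.exp_nat_mul, ← Real.exp_nat_mul, Real.exp_add]
          ring_nf
  -- The tangent inequality `t + 1 ≤ exp t` plays the role of Jensen.
  have htan : ∑ x : Fin m → Bool, (l * a x - K + 1) ≤ ∑ x, Real.exp (l * a x) * Real.exp (-K) := by
    refine Finset.sum_le_sum fun x _ => ?_
    rw [← Real.exp_add, ← sub_eq_add_neg]
    exact Real.add_one_le_exp _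
  rw [← Finset.sum_mul, Finset.sum_add_distrib, Finset.sum_sub_distrib, ← Finset.mul_sum] at htan
  have hK : Real.exp K * Real.exp (-K) = 1 := by rw [← Real.exp_add]; simp
  have h2 := mul_le_mul_of_nonneg_right hsum (Real.exp_pos (-K)).le
  rw [mul_assoc, hK] at h2
  simp only [Finset.sum_const, Finset.card_univ, Fintype.card_pi, Fintype.card_bool,
    Finset.prod_const, Fintype.card_fin, nsmul_eq_mul, Nat.cast_pow, Nat.cast_ofNat] at htan
  linarith

variable {Ω : Type*} [MeasurableSpace Ω]

/-- The space lower bound for the one-way index problem with public coins: if `s` bits of message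
allow each bit of each string to be recovered with probability `1 - ρ`, then
`s ≥ 2 (1/2 - ρ)² m`. -/
theorem index_lower_bound (μ : Measure Ω) [IsProbabilityMeasure μ] {m s : ℕ} {ρ : ℝ}
    (hρ : ρ < 1 / 2)
    (M : Ω → (Fin m → Bool) → (Fin s → Bool)) (g : Ω → (Fin s → Bool) → (Fin m → Bool))
    (E : (Fin m → Bool) → Fin m → Set Ω) (hE : ∀ x i, MeasurableSet (E x i))
    (hEρ : ∀ x i, 1 - ρ ≤ μ.real (E x i))
    (hg : ∀ x i, ∀ ω ∈ E x i, g ω (M ω x) i = x i) :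
    2 * (1 / 2 - ρ) ^ 2 * m ≤ s := by
  -- This `l` maximizes `l (1/2 - ρ) - l²/8`.
  set l : ℝ := 4 * (1 / 2 - ρ) with hl
  have hl0 : 0 < l := by linarith
  have hint (x : Fin m → Bool) (i : Fin m) :
      Integrable ((E x i).indicator (1 : Ω → ℝ)) μ :=
    (integrable_const (1 : ℝ)).indicator (hE x i)
  have h1 : ∑ x, ∑ i, μ.real (E x i) = ∫ ω, ∑ x, ∑ i, (E x i).indicator (1 : Ω → ℝ) ω ∂μ := by
    rw [integral_finsetSum _ fun x _ => integrable_finsetSum _ fun i _ => hint x i]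
    refine Finset.sum_congr rfl fun x _ => ?_
    rw [integral_finsetSum _ fun i _ => hint x i]
    exact Finset.sum_congr rfl fun i _ => (integral_indicator_one (hE x i)).symm
  have h2 : ∫ ω, ∑ x, ∑ i, (E x i).indicator (1 : Ω → ℝ) ω ∂μ ≤
      ∫ _, (s + m * (l / 2 + l ^ 2 / 8)) * 2 ^ m / l ∂μ := by
    refine integral_mono
      (integrable_finsetSum _ fun x _ => integrable_finsetSum _ fun i _ => hint x i)
      (integrable_const _) fun ω => ?_
    change _ ≤ (s + m * (l / 2 + l ^ 2 / 8)) * 2 ^ m / l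
    rw [le_div_iff₀' hl0]
    refine le_trans (mul_le_mul_of_nonneg_left ?_ hl0.le) (sum_agreement_le (M ω) (g ω) l)
    refine Finset.sum_le_sum fun x _ => Finset.sum_le_sum fun i _ => ?_
    by_cases hω : ω ∈ E x i
    · simp [hω, hg x i ω hω]
    · rw [Set.indicator_of_notMem hω]
      split_ifs <;> norm_num
  have h3 : ∑ x : Fin m → Bool, ∑ _i : Fin m, (1 - ρ) ≤ ∑ x, ∑ i, μ.real (E x i) :=
    Finset.sum_le_sum fun x _ => Finset.sum_le_sum fun i _ => hEρ x i
  rw [integral_const, probReal_univ, one_smul] at h2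
  simp only [Finset.sum_const, Finset.card_univ, Fintype.card_pi, Fintype.card_bool,
    Finset.prod_const, Fintype.card_fin, nsmul_eq_mul, Nat.cast_pow, Nat.cast_ofNat] at h3
  have h4 := h3.trans (h1.le.trans h2)
  rw [le_div_iff₀' hl0] at h4
  have h5 : l * (m * (1 - ρ)) ≤ s + m * (l / 2 + l ^ 2 / 8) := by
    refine le_of_mul_le_mul_right ?_ (pow_pos (two_pos : (0 : ℝ) < 2) m)
    linarith
  rw [hl] at h5
  linarith

end Index

/-! ### Hard streams and the reduction -/

section HardStreams

/-- The stream that encodes the bit string `x`, the `j`-th bit being marked at `z j`, followed by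
many copies of `z i`. -/
def indexStream {m : ℕ} (z : Fin m → ℝ) (x : Fin m → Bool) (i : Fin m) : Fin (m + 3 * m) → ℝ :=
  Fin.append (fun j => if x j then z j else 0) fun _ => z i

/-- The number of `d`-separated points in an interval. -/
theorem card_filter_separated_le {m : ℕ} {z : Fin m → ℝ} {d p q : ℝ}
    (hd : ∀ j k : Fin m, j ≤ k → d * ((k : ℝ) - j) ≤ z k - z j)
    (hd0 : 0 < d) {T : Finset (Fin m)} (hT : ∀ j ∈ T, z j ∈ Set.Icc p q) (hne : T.Nonempty) :
    d * (T.card : ℝ) ≤ (q - p) + d := by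
  have hsub : T ⊆ Finset.Icc (T.min' hne) (T.max' hne) := fun j hj =>
    Finset.mem_Icc.2 ⟨T.min'_le j hj, T.le_max' j hj⟩
  have hle : T.min' hne ≤ T.max' hne := T.min'_le _ (T.max'_mem hne)
  have hc := Finset.card_le_card hsub
  rw [Fin.card_Icc] at hc
  have hle' : (T.min' hne : ℕ) ≤ T.max' hne := hle
  have hc' : (T.card : ℝ) ≤ (T.max' hne : ℝ) + 1 - (T.min' hne : ℝ) := by
    rw [le_sub_iff_add_le]
    exact_mod_cast (show T.card + (T.min' hne : ℕ) ≤ T.max' hne + 1 by lia)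
  have h1 := hd _ _ hle
  have h2 := (hT _ (T.min'_mem hne)).1
  have h3 := (hT _ (T.max'_mem hne)).2
  nlinarith [mul_le_mul_of_nonneg_left hc' hd0.le]

variable {m : ℕ} {z : Fin m → ℝ}

theorem natCard_indexStream (x : Fin m → Bool) (i : Fin m) (S : Set ℝ)
    [DecidablePred (· ∈ S)] :
    (Nat.card {k // indexStream z x i k ∈ S} : ℝ) =
      (∑ j, if (if x j then z j else 0) ∈ S then (1 : ℝ) else 0) +
        if z i ∈ S then 3 * (m : ℝ) else 0 := by
  rw [natCard_subtype_eq_sum, Fin.sum_univ_add]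
  simp only [indexStream, Fin.append_left, Fin.append_right]
  split_ifs <;> simp

/-- Separation by the mass `1/(4m)` of one item means that enlarging an interval around `z i` costs
at least as much length as it gains in marks. -/
theorem geometricDiscrepancy_indexStream (hm : 0 < m) (hz : ∀ j, z j ∈ Set.Icc (1 / 4 : ℝ) (3 / 4))
    (hsep : ∀ j k : Fin m, j ≤ k → 1 / (4 * (m : ℝ)) * ((k : ℝ) - j) ≤ z k - z j)
    (x : Fin m → Bool) (i : Fin m) :
    geometricDiscrepancy (indexStream z x i) =
      3 / 4 + if x i then 1 / (4 * (m : ℝ)) else 0 := by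
  classical
  have hm0 : (0 : ℝ) < m := by exact_mod_cast hm
  have hn : ((m + 3 * m : ℕ) : ℝ) = 4 * m := by push_cast; ring
  have hw : (0 : ℝ) < 1 / (4 * (m : ℝ)) := by positivity
  have hwm : 1 / (4 * (m : ℝ)) * m = 1 / 4 := by field_simp
  have hinj : ∀ j, z j = z i → j = i := by
    intro j hj
    rcases le_total j i with h | h
    · have := hsep j i h
      rw [hj, sub_self] at this
      have h' : (i : ℝ) - j ≤ 0 := by nlinarith
      have h'' : (i : ℕ) ≤ j := by exact_mod_cast sub_nonpos.1 h'
      exact le_antisymm h h''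
    · have := hsep i j h
      rw [hj, sub_self] at this
      have h' : (j : ℝ) - i ≤ 0 := by nlinarith
      have h'' : (j : ℕ) ≤ i := by exact_mod_cast sub_nonpos.1 h'
      exact le_antisymm h'' h
  apply le_antisymm
  · refine geometricDiscrepancy_le fun p q hp hpq hq => ?_
    rw [natCard_indexStream, hn, div_eq_mul_one_div, mul_comm _ (1 / (4 * (m : ℝ)))]
    set w : ℝ := 1 / (4 * (m : ℝ))
    set a : ℝ := ∑ j, if (if x j then z j else 0) ∈ Set.Icc p q then (1 : ℝ) else 0 with ha
    have ha0 : 0 ≤ a := Finset.sum_nonneg fun j _ => by split_ifs <;> norm_num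
    have ham : a ≤ m := by
      calc a ≤ ∑ _j : Fin m, (1 : ℝ) := Finset.sum_le_sum fun j _ => by split_ifs <;> norm_num
        _ = m := by simp
    have hwa0 : 0 ≤ w * a := by positivity
    have hwam : w * a ≤ 1 / 4 := hwm ▸ mul_le_mul_of_nonneg_left ham hw.le
    have hb : 0 ≤ (if x i then w else 0) := by split_ifs <;> [exact hw.le; exact le_rfl]
    have hzi := hz i
    by_cases hi : z i ∈ Set.Icc p q
    · rw [if_pos hi, mul_add, show w * (3 * (m : ℝ)) = 3 / 4 by linarith, abs_le]
      refine ⟨?_, by linarith⟩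
      suffices h : w * a ≤ (q - p) + if x i then w else 0 by linarith
      -- Only `p = 0` captures the dummies; then the length is at least `z i ≥ 1/4`, the mass of the
      -- whole prefix.
      rcases hp.eq_or_lt with rfl | hp
      · linarith [hi.2, hzi.1]
      set T : Finset (Fin m) := Finset.univ.filter fun j => z j ∈ Set.Icc p q
      have hT := card_filter_separated_le (T := T) (p := p) (q := q) hsep hw
        (fun j hj => (Finset.mem_filter.1 hj).2) ⟨i, by simp [T, hi.1, hi.2]⟩
      -- The index `i` always lies in `T` but contributes a mark only if its bit is set; the
      -- resulting `-1` cancels the `+ d` of the separation bound.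
      have haT : a ≤ T.card - 1 + if x i then 1 else 0 := by
        have hTs : (T.card : ℝ) = ∑ j, if z j ∈ Set.Icc p q then (1 : ℝ) else 0 := by
          rw [Finset.sum_boole]
        rw [ha, hTs, ← Finset.add_sum_erase _ _ (Finset.mem_univ i),
          ← Finset.add_sum_erase _ (fun j => if z j ∈ Set.Icc p q then (1 : ℝ) else 0)
            (Finset.mem_univ i), if_pos hi]
        have h0 : (0 : ℝ) ∉ Set.Icc p q := fun h => hp.not_ge h.1
        have hrest : ∑ j ∈ Finset.univ.erase i,
            (if (if x j then z j else 0) ∈ Set.Icc p q then (1 : ℝ) else 0) ≤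
            ∑ j ∈ Finset.univ.erase i, if z j ∈ Set.Icc p q then (1 : ℝ) else 0 := by
          refine Finset.sum_le_sum fun j _ => ?_
          cases x j
          · simp only [Bool.false_eq_true, if_false, if_neg h0]
            split_ifs <;> norm_num
          · simp
        have hfirst : (if (if x i then z i else 0) ∈ Set.Icc p q then (1 : ℝ) else 0) =
            if x i then 1 else 0 := by
          cases x i
          · simp only [Bool.false_eq_true, if_false, if_neg h0]
          · simp only [if_true, if_pos hi]
        linarith
      have := mul_le_mul_of_nonneg_left haT hw.le
      have e : w * (if x i then (1 : ℝ) else 0) = if x i then w else 0 := by simp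
      rw [mul_add, mul_sub, mul_one, e] at this
      linarith
    · rw [if_neg hi, add_zero, abs_le]
      refine ⟨by linarith, ?_⟩
      have : q - p ≤ 3 / 4 := by
        by_contra! h
        exact hi ⟨by linarith [hzi.1], by linarith [hzi.2]⟩
      linarith
  · have h := le_geometricDiscrepancy (indexStream z x i) (p := z i) (q := z i)
      (by linarith [(hz i).1]) le_rfl (by linarith [(hz i).2])
    refine le_trans (le_of_eq ?_) ((neg_le_abs _).trans h)
    rw [natCard_indexStream, hn, if_pos (Set.left_mem_Icc.2 (le_refl (z i)))]
    have hs : (∑ j, if (if x j then z j else 0) ∈ Set.Icc (z i) (z i) then (1 : ℝ) else 0) =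
        if x i then 1 else 0 := by
      rw [Finset.sum_eq_single i]
      · cases x i
        · have : (0 : ℝ) ≠ z i := by linarith [(hz i).1]
          simp [this]
        · simp
      · simp only [Set.Icc_self]
        intro j _ hj
        rw [if_neg]
        cases x j
        · have : (0 : ℝ) ≠ z i := by linarith [(hz i).1]
          simpa using this
        · simpa using fun h => hj (hinj j h)
      · simp
    rw [hs]
    split_ifs
    · field_simp; ring
    · field_simp; ring

/-- Points of the grid that are `1 / (4m)`-separated and lie in `[1/4, 3/4]`. -/
theorem exists_separated_gridPoints (m N : ℕ) (hm : 0 < m) (hN : 4 * m ≤ N) :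
    ∃ z : Fin m → ℝ, (∀ j, z j ∈ gridPoints N) ∧ (∀ j, z j ∈ Set.Icc (1 / 4 : ℝ) (3 / 4)) ∧
      ∀ j k : Fin m, j ≤ k → 1 / (4 * (m : ℝ)) * ((k : ℝ) - j) ≤ z k - z j := by
  have hm0 : (0 : ℝ) < m := by exact_mod_cast hm
  have hN' : 4 * (m : ℝ) ≤ N := by exact_mod_cast hN
  have hN0 : (0 : ℝ) < N := by linarith
  set a := N / 4 + 1
  set b := N / (4 * m) + 1
  have ha : (N : ℝ) / 4 ≤ a := by
    have : N ≤ 4 * a := by lia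
    have : (N : ℝ) ≤ 4 * a := by exact_mod_cast this
    linarith
  have ha' : (a : ℝ) ≤ N / 4 + 1 := by
    have : 4 * a ≤ N + 4 := by lia
    have : 4 * (a : ℝ) ≤ N + 4 := by exact_mod_cast this
    linarith
  have hb : (N : ℝ) / (4 * m) ≤ b := by
    have := (Nat.lt_floor_add_one ((N : ℝ) / ((4 * m : ℕ) : ℝ))).le
    rw [Nat.floor_div_eq_div] at this
    push_cast at this
    simpa [b] using this
  have hb' : (b : ℝ) ≤ N / (4 * m) + 1 := by
    have := Nat.cast_div_le (α := ℝ) (m := N) (n := 4 * m)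
    push_cast at this
    simpa [b] using this
  -- Rounding up offset and step costs at most `m ≤ N/4` grid units in all.
  have hle (j : Fin m) : ((a + j * b : ℕ) : ℝ) ≤ 3 / 4 * N := by
    have hj : (j : ℝ) + 1 ≤ m := by exact_mod_cast j.2
    have h1 : (j : ℝ) * b ≤ (m - 1) * (N / (4 * m) + 1) :=
      mul_le_mul (by linarith) hb' (by positivity) (by linarith [j.val.cast_nonneg (α := ℝ)])
    have h2 : (m : ℝ) * (N / (4 * m)) = N / 4 := by field_simp
    have h3 : 0 ≤ (N : ℝ) / (4 * m) := by positivity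
    push_cast
    nlinarith
  refine ⟨fun j => ((a + j * b : ℕ) : ℝ) / N, fun j => ⟨_, ?_, rfl⟩, fun j => ⟨?_, ?_⟩, ?_⟩
  · have : ((a + j * b : ℕ) : ℝ) ≤ N := by linarith [hle j]
    exact_mod_cast this
  · rw [le_div_iff₀ hN0]
    push_cast
    have : 0 ≤ (j : ℝ) * b := by positivity
    linarith
  · rw [div_le_iff₀ hN0]
    exact hle j
  · intro j k hjk
    have h1 : (0 : ℝ) ≤ (k : ℝ) - j := sub_nonneg.2 (by exact_mod_cast hjk)
    rw [← sub_div, le_div_iff₀ hN0]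
    push_cast
    have := mul_le_mul_of_nonneg_left hb h1
    calc 1 / (4 * (m : ℝ)) * ((k : ℝ) - j) * N = ((k : ℝ) - j) * (N / (4 * m)) := by ring
      _ ≤ ((k : ℝ) - j) * b := this
      _ = _ := by ring

/-- The space lower bound given by the index problem. -/
theorem StreamingAlgorithm.SolvesGeometricDiscrepancy.index_space_bound {Ω : Type*}
    [MeasurableSpace Ω] (μ : Measure Ω) [IsProbabilityMeasure μ] {m s N : ℕ} {ε ρ : ℝ}
    (hm : 0 < m) (hN : 4 * m ≤ N) (hε : 2 * ε < 1 / (4 * (m : ℝ))) (hρ : ρ < 1 / 2)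
    (A : StreamingAlgorithm Ω s)
    (hA : A.SolvesGeometricDiscrepancy μ ε ρ (m + 3 * m) (gridPoints N)) :
    2 * (1 / 2 - ρ) ^ 2 * m ≤ s := by
  obtain ⟨z, hzN, hz, hsep⟩ := exists_separated_gridPoints m N hm hN
  have hD := geometricDiscrepancy_indexStream hm hz hsep
  have hmem (x : Fin m → Bool) (i : Fin m) : ∀ k, indexStream z x i k ∈ gridPoints N := by
    intro k
    refine Fin.addCases (fun j => ?_) (fun j => ?_) k
    · rw [indexStream, Fin.append_left]
      split_ifs
      · exact hzN j
      · exact ⟨0, Nat.zero_le _, by simp⟩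
    · rw [indexStream, Fin.append_right]
      exact hzN i
  let M : Ω → (Fin m → Bool) → (Fin s → Bool) := fun ω x =>
    A.state ω m fun j => if x j then z j else 0
  let f : Ω → (Fin m → Bool) → (Fin m → Bool) := fun ω x i =>
    decide (3 / 4 + 1 / (8 * (m : ℝ)) < A.output ω (indexStream z x i))
  -- The decoder may see only the message; this lets `f` descend to messages, with an irrelevant
  -- default off the range of `M ω`.
  have hf (ω : Ω) : Function.FactorsThrough (f ω) (M ω) := by
    intro x x' h
    ext i
    have : A.output ω (indexStream z x i) = A.output ω (indexStream z x' i) :=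
      congrArg (A.out ω) (A.state_append_congr ω h (3 * m) fun _ => z i)
    simp only [f, this]
  refine index_lower_bound μ hρ M (fun ω => Function.extend (M ω) (f ω) fun _ _ => false)
    (fun x i => {ω | |A.output ω (indexStream z x i) -
      geometricDiscrepancy (indexStream z x i)| ≤ ε})
    (fun x i => A.measurableSet_output _ _ _) (fun x i => hA _ (hmem x i)) fun x i ω hω => ?_
  rw [(hf ω).extend_apply]
  have e : 1 / (4 * (m : ℝ)) = 2 * (1 / (8 * (m : ℝ))) := by field_simp; norm_num
  rw [Set.mem_ofPred_eq, hD, e, abs_le] at hω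
  rw [e] at hε
  cases hx : x i
  · rw [hx] at hω
    simp only [Bool.false_eq_true, if_false] at hω
    simp only [f, decide_eq_false_iff_not, not_lt]
    linarith
  · rw [hx] at hω
    simp only [if_true] at hω
    simp only [f, decide_eq_true_eq]
    linarith

end HardStreams

/-! ### A stream of small discrepancy -/

section UniformStream

theorem geometricDiscrepancy_zero {n : ℕ} (hn : 0 < n) :
    1 ≤ geometricDiscrepancy (fun _ : Fin n => (0 : ℝ)) := by
  refine le_trans (le_of_eq ?_)
    (le_geometricDiscrepancy _ (le_refl (0 : ℝ)) le_rfl zero_le_one)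
  have : (n : ℝ) ≠ 0 := by exact_mod_cast hn.ne'
  simp [this]

/-- Counts integers in `[u, v]`; `huv` keeps the bound nonnegative when there are none. -/
theorem natCard_fin_le {n : ℕ} {S : Fin n → Prop} {u v : ℝ} (huv : u ≤ v + 1)
    (h : ∀ i : Fin n, S i → u ≤ (i : ℝ) ∧ (i : ℝ) ≤ v) :
    (Nat.card {i // S i} : ℝ) ≤ v - u + 1 := by
  classical
  have hc : Nat.card {i // S i} ≤ (Finset.Icc ⌈u⌉ ⌊v⌋).card := by
    rw [Nat.card_eq_fintype_card, Fintype.card_subtype]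
    refine Finset.card_le_card_of_injOn (fun i => ((i : ℕ) : ℤ)) ?_ ?_
    · intro i hi
      have := h i (by simpa using hi)
      simp only [Finset.coe_Icc, Set.mem_Icc]
      exact ⟨Int.ceil_le.2 (by simpa using this.1), Int.le_floor.2 (by simpa using this.2)⟩
    · intro i _ j _ hij
      exact Fin.ext (by simpa using hij)
  rw [Int.card_Icc] at hc
  have h1 : (Nat.card {i // S i} : ℝ) ≤ ((⌊v⌋ + 1 - ⌈u⌉).toNat : ℝ) := by exact_mod_cast hc
  refine h1.trans ?_
  have h2 : (((⌊v⌋ + 1 - ⌈u⌉).toNat : ℤ) : ℝ) = ((max (⌊v⌋ + 1 - ⌈u⌉) 0 : ℤ) : ℝ) := by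
    rw [Int.ofNat_toNat]
  rw [Int.cast_natCast] at h2
  rw [h2]
  push_cast
  refine max_le ?_ (by linarith)
  linarith [Int.floor_le v, Int.le_ceil u]

/-- Since `n ≤ N`, rounding `i/n` down to the grid moves it by at most `1/n`. Upper counts are
direct; lower counts come from bounding the points on either side. -/
theorem geometricDiscrepancy_uniform_le {n N : ℕ} (hn : 0 < n) (hN : n ≤ N) :
    geometricDiscrepancy (fun i : Fin n => ((i * N / n : ℕ) : ℝ) / N) ≤ 4 / n := by
  have hn0 : (0 : ℝ) < n := by exact_mod_cast hn
  have hnN : (n : ℝ) ≤ N := by exact_mod_cast hN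
  have hN0 : (0 : ℝ) < N := by linarith
  have hx (i : Fin n) : n * (((i * N / n : ℕ) : ℝ) / N) ≤ i ∧
      (i : ℝ) ≤ n * (((i * N / n : ℕ) : ℝ) / N) + 1 := by
    have h1 : i * N / n * n ≤ i * N := Nat.div_mul_le_self _ _
    have h2 : i * N ≤ (i * N / n + 1) * n := by
      have := (Nat.lt_div_mul_add (a := i * N) hn).le
      linarith
    have h1' : ((i * N / n : ℕ) : ℝ) * n ≤ i * N := by exact_mod_cast h1
    have h2' : (i : ℝ) * N ≤ (((i * N / n : ℕ) : ℝ) + 1) * n := by exact_mod_cast h2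
    constructor
    · rw [← mul_div_assoc, div_le_iff₀ hN0]
      linarith
    · rw [← mul_div_assoc, ← sub_le_iff_le_add, le_div_iff₀ hN0]
      linarith
  refine geometricDiscrepancy_le fun p q hp hpq hq => ?_
  set x : Fin n → ℝ := fun i => ((i * N / n : ℕ) : ℝ) / N
  have hpq' : n * p ≤ n * q := mul_le_mul_of_nonneg_left hpq hn0.le
  have hup : (Nat.card {i : Fin n // x i ∈ Set.Icc p q} : ℝ) ≤ (n * q + 1) - n * p + 1 := by
    refine natCard_fin_le (by linarith) fun i hi => ?_
    have h1 := mul_le_mul_of_nonneg_left hi.1 hn0.le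
    have h2 := mul_le_mul_of_nonneg_left hi.2 hn0.le
    constructor <;> linarith [(hx i).1, (hx i).2]
  have hleft : (Nat.card {i : Fin n // x i < p} : ℝ) ≤ (n * p + 1) - 0 + 1 := by
    refine natCard_fin_le (by nlinarith) fun i hi => ⟨by positivity, ?_⟩
    have h1 := mul_le_mul_of_nonneg_left hi.le hn0.le
    linarith [(hx i).2]
  have hright : (Nat.card {i : Fin n // q < x i} : ℝ) ≤ (n - 1) - n * q + 1 := by
    refine natCard_fin_le (by nlinarith) fun i hi => ⟨?_, ?_⟩
    · have h1 := mul_le_mul_of_nonneg_left hi.le hn0.le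
      linarith [(hx i).1]
    · have : (i : ℝ) + 1 ≤ n := by exact_mod_cast i.2
      linarith
  have htot : (n : ℝ) ≤ (Nat.card {i : Fin n // x i ∈ Set.Icc p q} : ℝ) +
      Nat.card {i : Fin n // x i < p} + Nat.card {i : Fin n // q < x i} := by
    classical
    simp only [Nat.card_eq_fintype_card, Fintype.card_subtype]
    have hcov : (Finset.univ : Finset (Fin n)) ⊆
        (Finset.univ.filter (fun i => x i ∈ Set.Icc p q) ∪ Finset.univ.filter (fun i => x i < p)) ∪
          Finset.univ.filter (fun i => q < x i) := by
      intro i _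
      simp only [Finset.mem_union, Finset.mem_filter, Finset.mem_univ, true_and, Set.mem_Icc]
      by_contra! h
      exact absurd (h.1.1 h.1.2) (not_lt.2 h.2)
    have := (Finset.card_le_card hcov).trans ((Finset.card_union_le _ _).trans
      (Nat.add_le_add_right (Finset.card_union_le _ _) _))
    rw [Finset.card_univ, Fintype.card_fin] at this
    exact_mod_cast this
  rw [show (q - p) - (Nat.card {i : Fin n // x i ∈ Set.Icc p q} : ℝ) / n =
    (n * q - n * p - (Nat.card {i : Fin n // x i ∈ Set.Icc p q} : ℝ)) / n by field_simp,
    abs_div, abs_of_pos hn0]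
  gcongr
  rw [abs_le]
  constructor <;> linarith

end UniformStream

/-! ### Choice of parameters -/

theorem mainTheorem9 :
    ∃ c : ℝ → ℝ, (∀ ρ : ℝ, 0 ≤ ρ → ρ < 1 / 2 → 0 < c ρ) ∧
      ∀ ε : ℝ, 0 < ε → ε < 1 / 2 →
        ∃ n : ℕ, 0 < n ∧ ∃ N₀ : ℕ, ∀ N : ℕ, N₀ ≤ N →
          ∀ ρ : ℝ, 0 ≤ ρ → ρ < 1 / 2 →
            ∀ (Ω : Type*) [MeasurableSpace Ω] (μ : Measure Ω) [IsProbabilityMeasure μ]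
              (s : ℕ) (A : StreamingAlgorithm Ω s),
              A.SolvesGeometricDiscrepancy μ ε ρ n (gridPoints N) →
                c ρ / ε ≤ (s : ℝ) := by
  refine ⟨fun ρ => (1 / 2 - ρ) ^ 2 / 8, fun ρ _ hρ => ?_, fun ε hε0 hε => ?_⟩
  · have : 0 < 1 / 2 - ρ := by linarith
    positivity
  rcases lt_or_ge ε (1 / 16) with hsmall | hlarge
  · have h16 : 2 ≤ 1 / (8 * ε) := by
      rw [le_div_iff₀ (by positivity)]
      linarith
    -- The largest `m` strictly below `1/(8ε)`, as the gap must exceed `2ε` strictly; `ε < 1/16`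
    -- gives `m ≥ 1`, hence `m + 1 ≤ 2m`.
    obtain ⟨m, hm⟩ : ∃ m, ⌈1 / (8 * ε)⌉₊ = m + 1 :=
      Nat.exists_eq_add_one.2 (Nat.ceil_pos.2 (by linarith))
    have h1 : 1 / (8 * ε) ≤ (m : ℝ) + 1 := by
      have := Nat.le_ceil (1 / (8 * ε))
      rw [hm] at this
      exact_mod_cast this
    have h2 : (m : ℝ) < 1 / (8 * ε) := Nat.lt_ceil.1 (by lia)
    have hm1 : (1 : ℝ) ≤ m := by linarith
    have hm0 : 0 < m := by exact_mod_cast zero_lt_one.trans_le hm1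
    have hgap : 2 * ε < 1 / (4 * (m : ℝ)) := by
      rw [lt_div_iff₀ (by positivity)] at h2 ⊢
      linarith
    refine ⟨m + 3 * m, by lia, 4 * m, fun N hN ρ _ hρ Ω _ μ _ s A hA => ?_⟩
    refine le_trans ?_ (hA.index_space_bound μ hm0 hN hgap hρ A)
    have h3 : 1 / (8 * ε) ≤ 2 * (m : ℝ) := by linarith
    calc (1 / 2 - ρ) ^ 2 / 8 / ε = (1 / 2 - ρ) ^ 2 * (1 / (8 * ε)) := by field_simp
      _ ≤ (1 / 2 - ρ) ^ 2 * (2 * (m : ℝ)) := by gcongr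
      _ = 2 * (1 / 2 - ρ) ^ 2 * m := by ring
  · have hgap : 0 < 1 - 2 * ε := by linarith
    obtain ⟨n, hn⟩ := exists_nat_gt (4 / (1 - 2 * ε))
    have hn0 : (0 : ℝ) < n := lt_trans (by positivity) hn
    have hn' : 0 < n := by exact_mod_cast hn0
    refine ⟨n, hn', n, fun N hN ρ hρ0 hρ Ω _ μ _ s A hA => ?_⟩
    have hs : 1 ≤ s := by
      refine hA.space_pos A μ hρ (P := fun i => ((i * N / n : ℕ) : ℝ) / N) (Q := fun _ => 0)
        (fun i => ⟨_, ?_, rfl⟩) (fun i => ⟨0, Nat.zero_le _, by simp⟩) ?_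
      · rw [Nat.div_le_iff_le_mul_add_pred hn']
        have := Nat.mul_le_mul_right N i.2.le
        lia
      · have h1 := geometricDiscrepancy_uniform_le hn' hN
        have h2 := geometricDiscrepancy_zero hn'
        have h3 : 4 / (n : ℝ) < 1 - 2 * ε := by
          rw [div_lt_iff₀ hgap] at hn
          rw [div_lt_iff₀ hn0]
          linarith
        linarith
    have hs' : (1 : ℝ) ≤ s := by exact_mod_cast hs
    -- Here `c ρ ≤ 1/32` and `ε ≥ 1/16`, so one bit exceeds the bound.
    refine le_trans ?_ hs'
    rw [div_le_one hε0]
    nlinarith
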